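/- Let $\Delta$ be a finite (abstract) simplicial complex containing the empty face, let $d-1$ be its dimension, let $f_{i-1}^\Delta$ be the number of its faces with exactly $i$ elements ($0\le i\le d$), and let its $h$-vector $(h_0^\Delta,\ldots,h_d^\Delta)$ be defined by $\sum_{i=0}^d h_i^\Delta x^{d-i}=\sum_{i=0}^d f_{i-1}^\Delta (x-1)^{d-i}$. Consider the conditions $$(1)\qquad h_0^\Delta,\ldots,h_d^\Delta>0\ \text{ and }\ \frac{h_0^\Delta}{h_d^\Delta}\le\frac{h_1^\Delta}{h_{d-1}^\Delta}\le\cdots\le\frac{h_{d-1}^\Delta}{h_1^\Delta}\le\frac{h_d^\Delta}{h_0^\Delta},$$ $$(2)\qquad h_1^\Delta,\ldots,h_{d-1}^\Delta>0,\quad h_d^\Delta=0\ \text{ and }\ \frac{h_1^\Delta}{h_{d-1}^\Delta}\ge\cdots\ge\frac{h_{d-2}^\Delta}{h_2^\Delta}\ge\frac{h_{d-1}^\Delta}{h_1^\Delta}.$$ Let $\mathrm{sd}(\Delta)$ be the barycentric subdivision of $\Delta$, i.e. the simplicial complex whose vertices are the nonempty faces of $\Delta$ and whose faces are the sets of nonempty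 faces of $\Delta$ that are totally ordered by inclusion. If $\Delta$ satisfies (1), then $\mathrm{sd}(\Delta)$ satisfies (1); if $\Delta$ satisfies (2), then $\mathrm{sd}(\Delta)$ satisfies (2). -/

import Mathlib

open Polynomial

namespace PreAbstractSimplicialComplex

/-- The number `d = dim K + 1`, i.e. the largest cardinality of a face of `K`. The empty set is
regarded as a face of every complex (it is not recorded in `K.faces`), so the complex whose only
face is the empty set has dimension `-1` and `d = 0`. -/
noncomputable def dimSucc {ι : Type*} (K : PreAbstractSimplicialComplex ι) : ℕ :=
  sSup (Finset.card '' K.faces)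

/-- The entry `f_{i-1}` of the `f`-vector: the number of faces with `i` elements (that is, of
dimension `i - 1`). The empty face, which is not recorded in `K.faces`, gives `f_{-1} = 1`. -/
noncomputable def numFaces {ι : Type*} (K : PreAbstractSimplicialComplex ι) (i : ℕ) : ℕ :=
  if i = 0 then 1 else {σ ∈ K.faces | σ.card = i}.ncard

/-- The `f`-polynomial `∑_{i=0}^d f_{i-1} x^{d-i}`. -/
noncomputable def fPoly {ι : Type*} (K : PreAbstractSimplicialComplex ι) : ℤ[X] :=
  ∑ i ∈ Finset.range (K.dimSucc + 1), C (K.numFaces i : ℤ) * X ^ (K.dimSucc - i)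

/-- The `h`-polynomial `h(x) = f(x - 1)`. -/
noncomputable def hPoly {ι : Type*} (K : PreAbstractSimplicialComplex ι) : ℤ[X] :=
  K.fPoly.comp (X - 1)

/-- The entry `h_i` (`0 ≤ i ≤ d`) of the `h`-vector: `h(x) = ∑_{i=0}^d h_i x^{d-i}`. -/
noncomputable def hVec {ι : Type*} (K : PreAbstractSimplicialComplex ι) (i : ℕ) : ℤ :=
  K.hPoly.coeff (K.dimSucc - i)

/-- The ratio `h_i / h_{d-i}`, for `0 ≤ i ≤ d`. -/
noncomputable def hRatio {ι : Type*} (K : PreAbstractSimplicialComplex ι) (i : ℕ) : ℝ :=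
  (K.hVec i : ℝ) / (K.hVec (K.dimSucc - i) : ℝ)

/-- `h_0, …, h_d > 0` and `h_0 / h_d ≤ h_1 / h_{d-1} ≤ ⋯ ≤ h_{d-1} / h_1 ≤ h_d / h_0`. -/
def IncreasingRatios {ι : Type*} (K : PreAbstractSimplicialComplex ι) : Prop :=
  (∀ i, i ≤ K.dimSucc → 0 < K.hVec i) ∧
    ∀ i, i + 1 ≤ K.dimSucc → K.hRatio i ≤ K.hRatio (i + 1)

/-- `h_1, …, h_{d-1} > 0`, `h_d = 0` and
`h_1 / h_{d-1} ≥ h_2 / h_{d-2} ≥ ⋯ ≥ h_{d-1} / h_1`. -/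
def DecreasingRatios {ι : Type*} (K : PreAbstractSimplicialComplex ι) : Prop :=
  (∀ i, 1 ≤ i → i + 1 ≤ K.dimSucc → 0 < K.hVec i) ∧
    K.hVec K.dimSucc = 0 ∧
    ∀ i, 1 ≤ i → i + 2 ≤ K.dimSucc → K.hRatio (i + 1) ≤ K.hRatio i

/-- The barycentric subdivision: its vertices are the nonempty faces of `K`, and its faces are the
sets of nonempty faces of `K` that are totally ordered by inclusion. -/
def barycentricSubdivision {ι : Type*} (K : PreAbstractSimplicialComplex ι) :
    PreAbstractSimplicialComplex (Finset ι) where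
  faces := {c | c.Nonempty ∧ (∀ σ ∈ c, σ ∈ K.faces) ∧
    IsChain (fun σ τ : Finset ι => σ ⊆ τ) (c : Set (Finset ι))}
  isRelLowerSet_faces := fun {_} hc =>
    ⟨hc.1, fun _ hts ht => ⟨ht, fun σ hσ => hc.2.1 σ (hts hσ),
      IsChain.mono (fun _ h => hts h) hc.2.2⟩⟩

end PreAbstractSimplicialComplex

/-! Write F_r for `descentPoly d r`. The h-polynomial of the subdivision is the image of that of Δ
under the linear map X^r ↦ F_r (`hPoly_barycentricSubdivision`). On the basis (X - 1)^(d-i) this map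
counts the chains whose top is a face of size i (`descentTransform_X_sub_one_pow`).

After clearing denominators, (1) and (2) say that the 2 × (d+1) matrix with rows (h_{d-r}) and (h_r)
has all its 2 × 2 minors of one sign. Since F_r and F_{d-r} are reverses of each other
(`coeff_rev`), the same matrix for the subdivision is the product of this one with the coefficient
array of the F_r. That array has nonnegative 2 × 2 minors (`coeff_mul_coeff_le`), so Cauchy–Binet
(`sum_mul_sum_le_of_minors`) preserves the sign. Positivity and the vanishing of h_d are read off
from the coefficients of the F_r. -/

/-! ### Descent polynomials. -/

/-- For `r ≤ d`, the generating polynomial by descents of the permutations of `{0, …, d}` whose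
first letter is `r`; the family is extended to all indices by `F_{r + d + 1} = X * F_r`. -/
noncomputable def descentPoly : ℕ → ℕ → ℤ[X]
  | 0, t => X ^ t
  | d + 1, t => ∑ u ∈ Finset.range (d + 1), descentPoly d (t - t / (d + 2) + u)

namespace descentPoly

theorem succ_eq (d t : ℕ) : descentPoly (d + 1) t =
    ∑ u ∈ Finset.range (d + 1), descentPoly d (t - t / (d + 2) + u) := rfl

/-- The sum runs over the second letter, relabelled after deleting the first letter `t`: indices up
to `d` are ascents, and those that wrap around carry the factor `X` of a descent. -/
theorem succ_of_lt {d t : ℕ} (h : t < d + 2) :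
    descentPoly (d + 1) t = ∑ u ∈ Finset.range (d + 1), descentPoly d (t + u) := by
  rw [succ_eq, Nat.div_eq_of_lt h, Nat.sub_zero]

theorem shift (d t : ℕ) : descentPoly d (t + (d + 1)) = X * descentPoly d t := by
  induction d generalizing t with
  | zero => simp [descentPoly, pow_succ']
  | succ d ih =>
    rw [succ_eq, succ_eq, Finset.mul_sum]
    refine Finset.sum_congr rfl fun u _ => ?_
    have h1 : (t + (d + 1 + 1)) / (d + 2) = t / (d + 2) + 1 := Nat.add_div_right _ (by omega)
    rw [← ih, h1]
    have h2 := Nat.div_le_self t (d + 2)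
    generalize t / (d + 2) = q at h2
    congr 1
    omega

/-- Adjacent windows differ only in their end terms, which are `X * F_r` and `F_r`. -/
theorem succ_sub {d r : ℕ} (h : r ≤ d) :
    descentPoly (d + 1) (r + 1) - descentPoly (d + 1) r = (X - 1) * descentPoly d r := by
  rw [succ_of_lt (by omega), succ_of_lt (by omega), Finset.sum_range_succ, Finset.sum_range_succ',
    show r + 1 + d = r + (d + 1) by ring, shift]
  simp only [add_assoc, add_comm 1, add_zero]
  ring

theorem succ_self (d : ℕ) : descentPoly (d + 1) (d + 1) = X * descentPoly (d + 1) 0 := by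
  rw [succ_of_lt (by omega), succ_of_lt (by omega), Finset.mul_sum]
  refine Finset.sum_congr rfl fun u _ => ?_
  rw [← shift, zero_add, add_comm]

theorem natDegree_le {d r : ℕ} (h : r ≤ d) : (descentPoly d r).natDegree ≤ d := by
  induction d generalizing r with
  | zero => simp [descentPoly, Nat.le_zero.1 h]
  | succ d ih =>
    induction r with
    | zero =>
      rw [succ_of_lt (by omega)]
      refine natDegree_sum_le_of_forall_le _ _ fun u hu => ?_
      rw [zero_add]
      exact (ih (Finset.mem_range_succ_iff.1 hu)).trans d.le_succ
    | succ r ihr =>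
      rw [← sub_add_cancel (descentPoly (d + 1) (r + 1)) (descentPoly (d + 1) r),
        succ_sub (by omega)]
      refine natDegree_add_le_of_degree_le ?_ (ihr (by omega))
      have h1 : (X - 1 : ℤ[X]).natDegree ≤ 1 := natDegree_X_sub_C_le 1
      rw [add_comm d 1]
      exact natDegree_mul_le_of_le h1 (ih (by omega))

/-- Complementing the letters exchanges ascents and descents. The induction on `r` moves along
`succ_sub`, starting from `succ_self`. -/
theorem coeff_rev {d r j : ℕ} (hr : r ≤ d) (hj : j ≤ d) :
    (descentPoly d r).coeff (d - j) = (descentPoly d (d - r)).coeff j := by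
  induction d generalizing r j with
  | zero => simp [Nat.le_zero.1 hr, Nat.le_zero.1 hj]
  | succ d ih =>
    induction r with
    | zero =>
      rw [Nat.sub_zero, succ_self, succ_of_lt (by omega)]
      simp only [zero_add]
      rcases j with _ | j
      · rw [mul_coeff_zero, coeff_X_zero, zero_mul]
        refine coeff_eq_zero_of_natDegree_lt (Nat.lt_of_le_of_lt ?_ d.lt_succ_self)
        exact natDegree_sum_le_of_forall_le _ _ fun u hu =>
          natDegree_le (Finset.mem_range_succ_iff.1 hu)
      · rw [coeff_X_mul, finsetSum_coeff, finsetSum_coeff,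
          ← Finset.sum_range_reflect (fun u => (descentPoly d u).coeff j)]
        refine Finset.sum_congr rfl fun u hu => ?_
        rw [Nat.add_sub_add_right, ih (Finset.mem_range_succ_iff.1 hu) (by omega)]
        simp
    | succ r ihr =>
      have h1 := congrArg (fun p => p.coeff (d + 1 - j)) (succ_sub (d := d) (r := r) (by omega))
      have h2 := congrArg (fun p => p.coeff j) (succ_sub (d := d) (r := d - r) (by omega))
      simp only [coeff_sub, sub_mul, one_mul] at h1 h2
      rw [show d - r + 1 = d + 1 - r by omega] at h2
      have h3 := ihr (by omega)
      have h4 : (X * descentPoly d r).coeff (d + 1 - j) = (descentPoly d (d - r)).coeff j := by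
        rcases Nat.lt_or_ge d j with h | h
        · rw [show d + 1 - j = 0 by omega, mul_coeff_zero, coeff_X_zero, zero_mul,
            coeff_eq_zero_of_natDegree_lt ((natDegree_le (by omega)).trans_lt h)]
        · rw [show d + 1 - j = d - j + 1 by omega, coeff_X_mul, ih (by omega) h]
      have h5 : (descentPoly d r).coeff (d + 1 - j) = (X * descentPoly d (d - r)).coeff j := by
        rcases j with _ | j
        · rw [mul_coeff_zero, coeff_X_zero, zero_mul,
            coeff_eq_zero_of_natDegree_lt ((natDegree_le (by omega)).trans_lt (by omega))]
        · rw [coeff_X_mul, Nat.add_sub_add_right, ih (by omega) (by omega)]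
      rw [show d + 1 - (r + 1) = d - r by omega]
      linarith

theorem coeff_nonneg (d t j : ℕ) : 0 ≤ (descentPoly d t).coeff j := by
  induction d generalizing t with
  | zero =>
    rw [descentPoly, coeff_X_pow]
    split_ifs <;> simp
  | succ d ih =>
    rw [succ_eq, finsetSum_coeff]
    exact Finset.sum_nonneg fun u _ => ih _

theorem coeff_zero_of_pos (d : ℕ) {t : ℕ} (ht : 0 < t) : (descentPoly d t).coeff 0 = 0 := by
  induction d generalizing t with
  | zero => simp [descentPoly, ht.ne]
  | succ d ih =>
    rw [succ_eq, finsetSum_coeff]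
    have := Nat.div_lt_self ht (show 1 < d + 2 by omega)
    exact Finset.sum_eq_zero fun u _ => ih (by omega)

theorem le_coeff_succ {d t u : ℕ} (ht : t < d + 2) (hu : u ≤ d) (j : ℕ) :
    (descentPoly d (t + u)).coeff j ≤ (descentPoly (d + 1) t).coeff j := by
  rw [succ_of_lt ht, finsetSum_coeff]
  exact Finset.single_le_sum (f := fun u => (descentPoly d (t + u)).coeff j)
    (fun u _ => coeff_nonneg d _ j) (Finset.mem_range_succ_iff.2 hu)

theorem coeff_zero_pos {d j : ℕ} (hj : j ≤ d) : 0 < (descentPoly (d + 1) 0).coeff j := by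
  induction d generalizing j with
  | zero => simp [descentPoly, Nat.le_zero.1 hj]
  | succ d ih =>
    rcases Nat.lt_or_ge d j with h | h
    -- Only the top degree needs the last summand, `X` times the previous polynomial; lower degrees
    -- come from `u = 0`.
    · refine lt_of_lt_of_le ?_ (le_coeff_succ (u := d + 1) (by omega) le_rfl j)
      obtain rfl : j = d + 1 := by omega
      rw [zero_add, succ_self, coeff_X_mul]
      exact ih le_rfl
    · exact (ih h).trans_le (le_coeff_succ (u := 0) (by omega) (by omega) j)

theorem coeff_one_pos {d j : ℕ} (hj : j ≤ d) : 0 < (descentPoly (d + 2) 1).coeff (j + 1) := by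
  refine lt_of_lt_of_le ?_ (le_coeff_succ (u := d + 1) (by omega) le_rfl (j + 1))
  rw [show 1 + (d + 1) = 0 + (d + 1 + 1) by ring, shift, coeff_X_mul]
  exact coeff_zero_pos hj

theorem exists_coeff_pos {d j : ℕ} (hj : j ≤ d) : ∃ r ≤ d, 0 < (descentPoly d r).coeff j := by
  rcases d with _ | d
  · exact ⟨0, le_rfl, by simp [descentPoly, Nat.le_zero.1 hj]⟩
  rcases Nat.lt_or_ge d j with h | h
  · refine ⟨d + 1, le_rfl, ?_⟩
    obtain rfl : j = d + 1 := by omega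
    rw [succ_self, coeff_X_mul]
    exact coeff_zero_pos le_rfl
  · exact ⟨0, by omega, coeff_zero_pos h⟩

/-- The coefficient array of `descentPoly d` is totally nonnegative of order two. -/
theorem coeff_mul_coeff_le (d : ℕ) {s t i j : ℕ} (hst : s ≤ t) (hij : i ≤ j) :
    (descentPoly d s).coeff j * (descentPoly d t).coeff i ≤
      (descentPoly d s).coeff i * (descentPoly d t).coeff j := by
  induction d generalizing s t with
  | zero =>
    simp only [descentPoly, coeff_X_pow]
    split_ifs <;> omega
  | succ d ih =>
    -- Minors are bilinear, so the inductive inequality passes to sums over index sets lying one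
    -- before the other.
    have hsum : ∀ S T : Finset ℕ, (∀ a ∈ S, ∀ b ∈ T, a ≤ b) →
        (∑ a ∈ S, descentPoly d a).coeff j * (∑ b ∈ T, descentPoly d b).coeff i ≤
          (∑ a ∈ S, descentPoly d a).coeff i * (∑ b ∈ T, descentPoly d b).coeff j := by
      intro S T h
      simp only [finsetSum_coeff, Finset.sum_mul_sum]
      exact Finset.sum_le_sum fun a ha => Finset.sum_le_sum fun b hb => ih (h a ha b hb)
    have hwin : ∀ t, descentPoly (d + 1) t =
        ∑ a ∈ Finset.Ico (t - t / (d + 2)) (t - t / (d + 2) + (d + 1)), descentPoly d a := by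
      intro t
      rw [Finset.sum_Ico_eq_sum_range, Nat.add_sub_cancel_left]
      rfl
    -- Thanks to the extension by `X`, every polynomial is a sum over a window of consecutive
    -- indices, and the start of the window is monotone over all periods.
    have hmono : s - s / (d + 2) ≤ t - t / (d + 2) := by
      have h1 := Nat.div_add_mod s (d + 2)
      have h2 := Nat.div_add_mod t (d + 2)
      have h3 := Nat.mod_lt s (show 0 < d + 2 by omega)
      have h4 := Nat.div_le_div_right (c := d + 2) hst
      obtain ⟨k, hk⟩ := Nat.exists_eq_add_of_le h4
      rw [hk] at h2 ⊢
      rcases k with _ | k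
      · omega
      · have h5 : s / (d + 2) + (k + 1) ≤ (d + 2) * (s / (d + 2) + (k + 1)) :=
          Nat.le_mul_of_pos_left _ (by omega)
        have h6 : (d + 2) * (s / (d + 2) + (k + 1)) =
          (d + 2) * (s / (d + 2)) + (d + 1) * k + k + (d + 2) := by ring
        omega
    rw [hwin s, hwin t]
    generalize s - s / (d + 2) = a at hmono
    generalize t - t / (d + 2) = b at hmono
    rcases Nat.lt_or_ge (a + (d + 1)) b with h | h
    · refine hsum _ _ fun x hx y hy => ?_
      rw [Finset.mem_Ico] at hx hy
      omega
    -- Overlapping windows are P + Q and Q + R, with Q the overlap. The minor splits into those of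
    -- (P, Q), (P, R), (Q, R), which are nonnegative, and that of (Q, Q), which is zero.
    · rw [← Finset.sum_Ico_consecutive _ hmono h,
        ← Finset.sum_Ico_consecutive _ h (show a + (d + 1) ≤ b + (d + 1) by omega)]
      have hPQ := hsum (Finset.Ico a b) (Finset.Ico b (a + (d + 1))) fun x hx y hy => by
        rw [Finset.mem_Ico] at hx hy
        omega
      have hPR := hsum (Finset.Ico a b) (Finset.Ico (a + (d + 1)) (b + (d + 1))) fun x hx y hy => by
        rw [Finset.mem_Ico] at hx hy
        omega
      have hQR := hsum (Finset.Ico b (a + (d + 1))) (Finset.Ico (a + (d + 1)) (b + (d + 1)))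
        fun x hx y hy => by
          rw [Finset.mem_Ico] at hx hy
          omega
      simp only [coeff_add, add_mul, mul_add]
      linarith [mul_comm ((∑ a ∈ Finset.Ico b (a + (d + 1)), descentPoly d a).coeff i)
        ((∑ a ∈ Finset.Ico b (a + (d + 1)), descentPoly d a).coeff j)]

end descentPoly

/-! ### Cauchy–Binet for 2 × 2 minors. -/

/-- A nonnegative `2 × 2` minor of a product, by the Cauchy–Binet formula. -/
theorem sum_mul_sum_le_of_minors {α R : Type*} [LinearOrder α] [CommRing R] [LinearOrder R]
    [IsStrictOrderedRing R] (S : Finset α) (u v a b : α → R)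
    (huv : ∀ r ∈ S, ∀ s ∈ S, r ≤ s → u s * v r ≤ u r * v s)
    (hab : ∀ r ∈ S, ∀ s ∈ S, r ≤ s → a s * b r ≤ a r * b s) :
    (∑ r ∈ S, u r * b r) * ∑ s ∈ S, v s * a s ≤ (∑ r ∈ S, u r * a r) * ∑ s ∈ S, v s * b s := by
  have h0 : 0 ≤ ∑ r ∈ S, ∑ s ∈ S, (u r * v s - u s * v r) * (a r * b s - a s * b r) := by
    refine Finset.sum_nonneg fun r hr => Finset.sum_nonneg fun s hs => ?_
    rcases le_total r s with h | h
    · exact mul_nonneg (sub_nonneg.2 (huv r hr s hs h)) (sub_nonneg.2 (hab r hr s hs h))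
    · exact mul_nonneg_of_nonpos_of_nonpos (by linarith [huv s hs r hr h])
        (by linarith [hab s hs r hr h])
  -- Each unordered pair of indices is counted twice, whence the factor 2.
  have h1 : ∑ r ∈ S, ∑ s ∈ S, (u r * v s - u s * v r) * (a r * b s - a s * b r) =
      2 * ((∑ r ∈ S, u r * a r) * ∑ s ∈ S, v s * b s) -
        2 * ((∑ r ∈ S, u r * b r) * ∑ s ∈ S, v s * a s) := by
    have e : ∀ r s, (u r * v s - u s * v r) * (a r * b s - a s * b r) =
        ((u r * a r) * (v s * b s) + (v r * b r) * (u s * a s)) -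
          ((u r * b r) * (v s * a s) + (v r * a r) * (u s * b s)) := fun r s => by ring
    simp only [e, Finset.sum_sub_distrib, Finset.sum_add_distrib, ← Finset.sum_mul_sum]
    ring
  linarith

/-! ### Counting chains of sets with a given top. -/

/-- The number of chains of `k` nonempty sets with largest element a given set of size `n`
(ordered set partitions into `k` blocks). -/
def numChains : ℕ → ℕ → ℕ
  | n, 0 => if n = 0 then 1 else 0
  | n, k + 1 => ∑ j ∈ Finset.range n, n.choose j * numChains j k

theorem numChains_zero_succ (k : ℕ) : numChains 0 (k + 1) = 0 := by
  simp [numChains]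

theorem numChains_eq_zero {n k : ℕ} (h : n < k) : numChains n k = 0 := by
  induction k generalizing n with
  | zero => omega
  | succ k ih =>
    refine Finset.sum_eq_zero fun j hj => ?_
    rw [Finset.mem_range] at hj
    rw [ih (by omega), mul_zero]

theorem numChains_self_pos (n : ℕ) : 0 < numChains n n := by
  induction n with
  | zero => simp [numChains]
  | succ n ih =>
    refine Finset.sum_pos' (fun _ _ => Nat.zero_le _) ⟨n, by simp, ?_⟩
    exact Nat.mul_pos (Nat.choose_pos n.le_succ) ih

open Classical in
/-- The chains of `k` nonempty sets with union `σ`. -/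
noncomputable def chainsTo {ι : Type*} (σ : Finset ι) (k : ℕ) : Finset (Finset (Finset ι)) :=
  σ.powerset.powerset.filter fun c =>
    ∅ ∉ c ∧ IsChain (fun σ τ : Finset ι => σ ⊆ τ) (c : Set (Finset ι)) ∧ c.sup id = σ ∧ c.card = k

open Classical in
theorem mem_chainsTo {ι : Type*} {σ : Finset ι} {k : ℕ} {c : Finset (Finset ι)} :
    c ∈ chainsTo σ k ↔ ∅ ∉ c ∧ IsChain (fun σ τ : Finset ι => σ ⊆ τ) (c : Set (Finset ι)) ∧
      c.sup id = σ ∧ c.card = k := by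
  rw [chainsTo, Finset.mem_filter, and_iff_right_iff_imp]
  rintro ⟨-, -, rfl, -⟩
  rw [Finset.mem_powerset]
  intro τ hτ
  rw [Finset.mem_powerset]
  exact Finset.le_sup (f := id) hτ

open Classical in
theorem IsChain.sup_id_mem {ι : Type*} {c : Finset (Finset ι)}
    (hc : IsChain (fun σ τ : Finset ι => σ ⊆ τ) (c : Set (Finset ι))) (hne : c.Nonempty) :
    c.sup id ∈ c := by
  obtain ⟨m, hm, hmax⟩ := c.exists_max_image Finset.card hne
  have h : c.sup id = m := by
    refine le_antisymm (Finset.sup_le fun x hx => ?_) (Finset.le_sup (f := id) hm)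
    rcases hc.total hx hm with h | h
    · exact h
    · exact (Finset.eq_of_subset_of_card_le h (hmax x hx)).ge
  rwa [h]

-- Deleting the top `σ` leaves a chain whose union `τ` is a proper subset. The value `τ = ∅`
-- corresponds to the chain `{σ}`.
open Classical in
theorem card_chainsTo_succ {ι : Type*} (σ : Finset ι) (k : ℕ) :
    (chainsTo σ (k + 1)).card = ∑ τ ∈ σ.ssubsets, (chainsTo τ k).card := by
  have key : ∀ c ∈ chainsTo σ (k + 1), σ ∈ c ∧ (c.erase σ).sup id ⊂ σ ∧
      c.erase σ ∈ chainsTo ((c.erase σ).sup id) k := by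
    intro c hc
    obtain ⟨h0, hch, hs, hk⟩ := mem_chainsTo.1 hc
    have hne : c.Nonempty := Finset.card_pos.1 (by omega)
    have hσ : σ ∈ c := hs ▸ hch.sup_id_mem hne
    have hch' : IsChain (fun σ τ : Finset ι => σ ⊆ τ) ((c.erase σ : Finset _) : Set (Finset ι)) :=
      hch.mono fun _ h => Finset.erase_subset _ _ h
    refine ⟨hσ, ?_, mem_chainsTo.2 ⟨fun h => h0 (Finset.mem_of_mem_erase h), hch', rfl, ?_⟩⟩
    · rw [Finset.ssubset_iff_subset_ne]
      refine ⟨?_, fun h => ?_⟩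
      · conv_rhs => rw [← hs]
        exact Finset.sup_mono (Finset.erase_subset _ _)
      · rcases (c.erase σ).eq_empty_or_nonempty with he | he
        · rw [he, Finset.sup_empty] at h
          exact h0 (Finset.bot_eq_empty ▸ h ▸ hσ)
        · have hm := hch'.sup_id_mem he
          rw [h] at hm
          exact Finset.notMem_erase σ c hm
    · rw [Finset.card_erase_of_mem hσ, hk, Nat.add_sub_cancel]
  rw [Finset.card_eq_sum_card_fiberwise (f := fun c => (c.erase σ).sup id) (t := σ.ssubsets)
    fun c hc => Finset.mem_coe.2 (Finset.mem_ssubsets.2 (key c hc).2.1)]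
  refine Finset.sum_congr rfl fun τ hτ => ?_
  rw [Finset.mem_ssubsets] at hτ
  have hnot : ∀ c ∈ chainsTo τ k, σ ∉ c := by
    intro c hc h
    obtain ⟨-, -, hs, -⟩ := mem_chainsTo.1 hc
    exact hτ.2 (hs ▸ Finset.le_sup (f := id) h)
  refine Finset.card_nbij' (fun c => c.erase σ) (fun c => insert σ c) ?_ ?_ ?_ ?_
  · intro c hc
    obtain ⟨hc, h⟩ := Finset.mem_filter.1 (Finset.mem_coe.1 hc)
    exact h ▸ (key c hc).2.2
  · intro c hc
    have hn := hnot c hc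
    obtain ⟨h0, hch, hs, hk⟩ := mem_chainsTo.1 hc
    refine Finset.mem_filter.2 ⟨mem_chainsTo.2 ⟨?_, ?_, ?_, ?_⟩, ?_⟩
    · rw [Finset.mem_insert, not_or]
      refine ⟨fun h => hτ.2 ?_, h0⟩
      rw [← h]
      exact Finset.empty_subset _
    · rw [Finset.coe_insert]
      refine hch.insert fun b hb _ => Or.inr ?_
      exact (hs ▸ Finset.le_sup (f := id) hb : b ⊆ τ).trans hτ.1
    · rw [Finset.sup_insert, hs]
      exact sup_eq_left.2 hτ.1
    · rw [Finset.card_insert_of_notMem hn, hk]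
    · rw [Finset.erase_insert hn, hs]
  · intro c hc
    exact Finset.insert_erase (key c (Finset.mem_filter.1 hc).1).1
  · intro c hc
    exact Finset.erase_insert (hnot c hc)

open Classical in
theorem card_chainsTo {ι : Type*} (σ : Finset ι) (k : ℕ) :
    (chainsTo σ k).card = numChains σ.card k := by
  induction k generalizing σ with
  | zero =>
    rw [numChains]
    split_ifs with h
    · rw [Finset.card_eq_zero] at h
      rw [Finset.card_eq_one]
      refine ⟨∅, Finset.ext fun c => ?_⟩
      rw [mem_chainsTo, Finset.mem_singleton, Finset.card_eq_zero]
      refine ⟨fun h => h.2.2.2, ?_⟩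
      rintro rfl
      simp [h]
    · rw [Finset.card_eq_zero, Finset.eq_empty_iff_forall_notMem]
      intro c hc
      obtain ⟨-, -, hs, hk⟩ := mem_chainsTo.1 hc
      rw [Finset.card_eq_zero] at hk
      rw [hk, Finset.sup_empty] at hs
      exact h (hs ▸ Finset.card_empty)
  | succ k ih =>
    rw [card_chainsTo_succ, Finset.sum_congr rfl fun τ _ => ih τ, numChains]
    have h := Finset.sum_powerset_apply_card (fun j => numChains j k) (x := σ)
    rw [Finset.sum_range_succ, Nat.choose_self, one_smul] at h
    simp only [smul_eq_mul] at h
    rw [Finset.ssubsets, ← Nat.add_right_cancel_iff (n := numChains σ.card k), ← h]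
    exact Finset.sum_erase_add _ _ (Finset.mem_powerset_self σ)

/-! ### The f-vector and dimension of the subdivision. -/

namespace PreAbstractSimplicialComplex

variable {ι : Type*} {K : PreAbstractSimplicialComplex ι}

theorem numFaces_zero (K : PreAbstractSimplicialComplex ι) : K.numFaces 0 = 1 := if_pos rfl

theorem card_le_dimSucc (hK : K.faces.Finite) {σ : Finset ι} (hσ : σ ∈ K.faces) :
    σ.card ≤ K.dimSucc :=
  le_csSup (hK.image _).bddAbove (Set.mem_image_of_mem _ hσ)

theorem numFaces_dimSucc_pos (hK : K.faces.Finite) : 0 < K.numFaces K.dimSucc := by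
  rw [numFaces]
  split_ifs with h
  · exact one_pos
  · rcases K.faces.eq_empty_or_nonempty with he | he
    · exact absurd (by simp [dimSucc, he]) h
    · obtain ⟨σ, hσ, h⟩ := Nat.sSup_mem (he.image Finset.card) (hK.image _).bddAbove
      exact (Set.ncard_pos (hK.subset (Set.sep_subset _ _))).2 ⟨σ, hσ, h⟩

theorem numFaces_eq_zero (hK : K.faces.Finite) {i : ℕ} (hi : K.dimSucc < i) :
    K.numFaces i = 0 := by
  rw [numFaces, if_neg (by omega)]
  convert Set.ncard_empty (Finset ι)
  rw [Set.eq_empty_iff_forall_notMem]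
  rintro σ ⟨hσ, rfl⟩
  exact (card_le_dimSucc hK hσ).not_gt hi

theorem dimSucc_eq_of_numFaces (hK : K.faces.Finite) {d : ℕ} (hd : 0 < K.numFaces d)
    (h : ∀ i, d < i → K.numFaces i = 0) : K.dimSucc = d := by
  refine le_antisymm ?_ ?_
  · by_contra! hlt
    exact (numFaces_dimSucc_pos hK).ne' (h _ hlt)
  · by_contra! hlt
    exact hd.ne' (numFaces_eq_zero hK hlt)

theorem finite_faces_barycentricSubdivision (hK : K.faces.Finite) :
    K.barycentricSubdivision.faces.Finite := by
  refine (Finset.finite_toSet hK.toFinset.powerset).subset fun c hc => ?_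
  rw [Finset.mem_coe, Finset.mem_powerset]
  exact fun σ hσ => hK.mem_toFinset.2 (hc.2.1 σ hσ)

-- A nonempty chain of faces contains its union, so chains are sorted by this top face. The term `i
-- = 0` contributes only for `k = 0`, the empty chain.
open Classical in
theorem numFaces_barycentricSubdivision (hK : K.faces.Finite) (k : ℕ) :
    K.barycentricSubdivision.numFaces k =
      ∑ i ∈ Finset.range (K.dimSucc + 1), K.numFaces i * numChains i k := by
  rcases k with _ | k
  · rw [numFaces_zero, Finset.sum_range_succ', numFaces_zero, Finset.sum_eq_zero]
    · simp [numChains]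
    · intro i _
      simp [numChains]
  · have hset : {c ∈ K.barycentricSubdivision.faces | c.card = k + 1} =
        ((hK.toFinset.biUnion fun σ => chainsTo σ (k + 1) : Finset (Finset (Finset ι))) :
          Set (Finset (Finset ι))) := by
      ext c
      simp only [Finset.coe_biUnion, Set.mem_iUnion, Finset.mem_coe, Set.Finite.mem_toFinset,
        Set.mem_ofPred_eq, mem_chainsTo, exists_prop]
      constructor
      · rintro ⟨⟨hne, hf, hch⟩, hk⟩
        exact ⟨_, hf _ (hch.sup_id_mem hne),
          fun h => Finset.not_nonempty_empty (K.isRelLowerSet_faces (hf _ h)).1, hch, rfl, hk⟩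
      · rintro ⟨σ, hσ, h0, hch, rfl, hk⟩
        refine ⟨⟨Finset.card_pos.1 (by omega), fun τ hτ => ?_, hch⟩, hk⟩
        exact (K.isRelLowerSet_faces hσ).2 (Finset.le_sup (f := id) hτ)
          (Finset.nonempty_iff_ne_empty.2 fun h => h0 (h ▸ hτ))
    have hdisj : ((hK.toFinset : Finset (Finset ι)) : Set (Finset ι)).PairwiseDisjoint
        fun σ => chainsTo σ (k + 1) := by
      intro σ _ τ _ hne
      refine Finset.disjoint_left.2 fun c hc hc' => hne ?_
      rw [← (mem_chainsTo.1 hc).2.2.1, (mem_chainsTo.1 hc').2.2.1]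
    rw [numFaces, if_neg k.succ_ne_zero, hset, Set.ncard_coe_finset, Finset.card_biUnion hdisj,
      Finset.sum_congr rfl fun σ _ => card_chainsTo σ (k + 1),
      ← Finset.sum_fiberwise_of_maps_to (g := Finset.card) (t := Finset.range (K.dimSucc + 1))
        fun σ hσ => Finset.mem_range_succ_iff.2 (card_le_dimSucc hK (hK.mem_toFinset.1 hσ))]
    refine Finset.sum_congr rfl fun i _ => ?_
    rw [Finset.sum_congr rfl fun σ hσ => by rw [(Finset.mem_filter.1 hσ).2], Finset.sum_const,
      smul_eq_mul]
    rcases i with _ | i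
    · simp [numChains_zero_succ]
    · rw [numFaces, if_neg i.succ_ne_zero, ← Set.ncard_coe_finset]
      simp

theorem dimSucc_barycentricSubdivision (hK : K.faces.Finite) :
    K.barycentricSubdivision.dimSucc = K.dimSucc := by
  refine dimSucc_eq_of_numFaces (finite_faces_barycentricSubdivision hK) ?_ fun k hk => ?_
  · rw [numFaces_barycentricSubdivision hK]
    exact Finset.sum_pos' (fun _ _ => Nat.zero_le _) ⟨K.dimSucc, by simp,
      Nat.mul_pos (numFaces_dimSucc_pos hK) (numChains_self_pos _)⟩
  · rw [numFaces_barycentricSubdivision hK]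
    refine Finset.sum_eq_zero fun i hi => ?_
    rw [Finset.mem_range] at hi
    rw [numChains_eq_zero (by omega), mul_zero]

end PreAbstractSimplicialComplex

/-! ### The linear map on h-polynomials. -/

/-- The linear map sending `X ^ m` to `descentPoly d m` for `m ≤ d`. -/
noncomputable def descentTransform (d : ℕ) : ℤ[X] →ₗ[ℤ] ℤ[X] :=
  ∑ m ∈ Finset.range (d + 1), (lcoeff ℤ m).smulRight (descentPoly d m)

theorem descentTransform_apply (d : ℕ) (p : ℤ[X]) :
    descentTransform d p = ∑ m ∈ Finset.range (d + 1), p.coeff m • descentPoly d m := by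
  simp [descentTransform]

theorem descentTransform_X_pow {d m : ℕ} (h : m ≤ d) :
    descentTransform d (X ^ m) = descentPoly d m := by
  rw [descentTransform_apply, Finset.sum_eq_single m]
  · simp
  · intro b _ hb
    rw [coeff_X_pow, if_neg hb, zero_smul]
  · intro hm
    exact absurd (Finset.mem_range_succ_iff.2 h) hm

/-- This is `succ_sub` applied coefficientwise; the degree bound removes the extra top term. -/
theorem descentTransform_mul {d : ℕ} {p : ℤ[X]} (hp : p.natDegree ≤ d) :
    descentTransform (d + 1) ((X - 1) * p) = (X - 1) * descentTransform d p := by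
  have h : p.coeff (d + 1) = 0 := coeff_eq_zero_of_natDegree_lt (by omega)
  rw [sub_mul, one_mul, map_sub, descentTransform_apply, descentTransform_apply (d + 1) p,
    Finset.sum_range_succ', Finset.sum_range_succ _ (d + 1), h, mul_coeff_zero, coeff_X_zero,
    zero_mul, zero_smul, zero_smul, add_zero, add_zero, ← Finset.sum_sub_distrib,
    descentTransform_apply, Finset.mul_sum]
  refine Finset.sum_congr rfl fun m hm => ?_
  rw [coeff_X_mul, ← smul_sub, descentPoly.succ_sub (Finset.mem_range_succ_iff.1 hm),
    mul_smul_comm]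

/-- Expand X^(d+1) = (1 + (X - 1))^(d+1) and divide X^(d+1) - 1 by X - 1. -/
theorem geom_sum_eq_sum_choose (d : ℕ) : ∑ s ∈ Finset.range (d + 1), (X : ℤ[X]) ^ s =
    ∑ i ∈ Finset.range (d + 1), (d + 1).choose i • (X - 1 : ℤ[X]) ^ (d - i) := by
  have hX : (X - 1 : ℤ[X]) ≠ 0 := X_sub_C_ne_zero 1
  refine mul_right_cancel₀ hX ?_
  have h := add_pow (1 : ℤ[X]) (X - 1) (d + 1)
  rw [add_sub_cancel, Finset.sum_range_succ] at h
  rw [geom_sum_mul, h, Finset.sum_mul]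
  simp only [one_pow, one_mul, Nat.sub_self, pow_zero, Nat.choose_self, Nat.cast_one,
    add_sub_cancel_right]
  refine Finset.sum_congr rfl fun i hi => ?_
  rw [Nat.succ_sub (Finset.mem_range_succ_iff.1 hi), pow_succ, nsmul_eq_mul]
  ring

/-- A factor `X - 1` passes through the map, lowering `d`, until `i = d`. There the image of 1 in
degree `d + 1` equals the image of 1 + X + ⋯ + X^d in degree `d`, and its binomial expansion
reproduces the recursion of `numChains`. -/
theorem descentTransform_X_sub_one_pow {d i : ℕ} (hi : i ≤ d) :
    descentTransform d ((X - 1) ^ (d - i)) =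
      ∑ k ∈ Finset.range (d + 1), numChains i k • (X - 1 : ℤ[X]) ^ (d - k) := by
  induction d generalizing i with
  | zero =>
    obtain rfl := Nat.le_zero.1 hi
    simpa [numChains, descentPoly] using descentTransform_X_pow (le_refl 0)
  | succ d ih =>
    rcases Nat.lt_or_ge d i with h | h
    · obtain rfl : i = d + 1 := by omega
      have h0 : descentTransform (d + 1) 1 =
          descentTransform d (∑ s ∈ Finset.range (d + 1), X ^ s) := by
        rw [← pow_zero X, descentTransform_X_pow (by omega), descentPoly.succ_of_lt (by omega),
          map_sum]
        refine Finset.sum_congr rfl fun s hs => ?_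
        rw [zero_add, descentTransform_X_pow (Finset.mem_range_succ_iff.1 hs)]
      rw [Nat.sub_self, pow_zero, h0, geom_sum_eq_sum_choose, map_sum,
        Finset.sum_range_succ' _ (d + 1)]
      simp only [numChains, if_neg (Nat.succ_ne_zero d), zero_smul, add_zero,
        Nat.add_sub_add_right, Finset.sum_smul]
      rw [Finset.sum_comm]
      refine Finset.sum_congr rfl fun i hi => ?_
      rw [map_nsmul, ih (Finset.mem_range_succ_iff.1 hi), Finset.smul_sum]
      exact Finset.sum_congr rfl fun k _ => (mul_smul _ _ _).symm
    · have hdeg : ((X - 1 : ℤ[X]) ^ (d - i)).natDegree ≤ d := by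
        refine (natDegree_pow_le_of_le (d - i) (natDegree_X_sub_C_le (1 : ℤ))).trans ?_
        omega
      rw [Nat.succ_sub h, pow_succ', descentTransform_mul hdeg, ih h, Finset.sum_range_succ _ (d + 1),
        numChains_eq_zero (by omega), zero_smul, add_zero, Finset.mul_sum]
      refine Finset.sum_congr rfl fun k hk => ?_
      rw [Nat.succ_sub (Finset.mem_range_succ_iff.1 hk), pow_succ', mul_smul_comm]

/-! ### The h-vector of the subdivision and the two ratio conditions. -/

namespace PreAbstractSimplicialComplex

variable {ι : Type*} {K : PreAbstractSimplicialComplex ι}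

theorem hPoly_eq (K : PreAbstractSimplicialComplex ι) : K.hPoly =
    ∑ i ∈ Finset.range (K.dimSucc + 1), K.numFaces i • (X - 1 : ℤ[X]) ^ (K.dimSucc - i) := by
  simp [hPoly, fPoly]

theorem hPoly_barycentricSubdivision (hK : K.faces.Finite) :
    K.barycentricSubdivision.hPoly = descentTransform K.dimSucc K.hPoly := by
  rw [hPoly_eq, hPoly_eq, dimSucc_barycentricSubdivision hK, map_sum]
  simp only [numFaces_barycentricSubdivision hK, Finset.sum_smul]
  rw [Finset.sum_comm]
  refine Finset.sum_congr rfl fun i hi => ?_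
  rw [map_nsmul, descentTransform_X_sub_one_pow (Finset.mem_range_succ_iff.1 hi), Finset.smul_sum]
  simp only [mul_smul]

theorem coeff_hPoly_barycentricSubdivision (hK : K.faces.Finite) (m : ℕ) :
    K.barycentricSubdivision.hPoly.coeff m = ∑ r ∈ Finset.range (K.dimSucc + 1),
      K.hPoly.coeff r * (descentPoly K.dimSucc r).coeff m := by
  rw [hPoly_barycentricSubdivision hK, descentTransform_apply, finsetSum_coeff]
  simp

theorem coeff_hPoly_barycentricSubdivision_rev (hK : K.faces.Finite) {m : ℕ}
    (hm : m ≤ K.dimSucc) :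
    K.barycentricSubdivision.hPoly.coeff (K.dimSucc - m) = ∑ r ∈ Finset.range (K.dimSucc + 1),
      K.hPoly.coeff (K.dimSucc - r) * (descentPoly K.dimSucc r).coeff m := by
  rw [coeff_hPoly_barycentricSubdivision hK, ← Finset.sum_range_reflect]
  refine Finset.sum_congr rfl fun r hr => ?_
  have hr := Finset.mem_range_succ_iff.1 hr
  rw [Nat.add_sub_cancel, descentPoly.coeff_rev (Nat.sub_le _ _) hm, Nat.sub_sub_self hr]

theorem hVec_zero (K : PreAbstractSimplicialComplex ι) : K.hVec 0 = 1 := by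
  have hmonic : (X - 1 : ℤ[X]).Monic := monic_X_sub_C 1
  have hd : ∀ n, ((X - 1 : ℤ[X]) ^ n).natDegree = n := fun n => by
    rw [hmonic.natDegree_pow, show (X - 1 : ℤ[X]).natDegree = 1 from natDegree_X_sub_C 1, mul_one]
  rw [hVec, hPoly_eq, finsetSum_coeff, Finset.sum_range_succ', Finset.sum_eq_zero]
  · have h : ((X - 1 : ℤ[X]) ^ K.dimSucc).coeff K.dimSucc = 1 := by
      conv_lhs => rw [← hd K.dimSucc]
      rw [hd]
      exact (congrArg _ (hd _).symm).trans (hmonic.pow _).coeff_natDegree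
    simp [numFaces_zero, h]
  · intro i hi
    rw [Finset.mem_range] at hi
    rw [coeff_smul, coeff_eq_zero_of_natDegree_lt (by rw [hd]; omega), smul_zero]

theorem hRatio_eq {i : ℕ} (hi : i ≤ K.dimSucc) :
    K.hRatio i = (K.hPoly.coeff (K.dimSucc - i) : ℝ) / (K.hPoly.coeff i : ℝ) := by
  rw [hRatio, hVec, hVec, Nat.sub_sub_self hi]

/-- The condition that the ratios `h_i / h_{d-i}` increase, without division. -/
def IncreasingMinors (K : PreAbstractSimplicialComplex ι) : Prop :=
  ∀ i j, i ≤ j → j ≤ K.dimSucc → K.hPoly.coeff (K.dimSucc - i) * K.hPoly.coeff j ≤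
    K.hPoly.coeff (K.dimSucc - j) * K.hPoly.coeff i

/-- The condition that the ratios `h_i / h_{d-i}` decrease, without division. -/
def DecreasingMinors (K : PreAbstractSimplicialComplex ι) : Prop :=
  ∀ i j, i ≤ j → j ≤ K.dimSucc → K.hPoly.coeff (K.dimSucc - j) * K.hPoly.coeff i ≤
    K.hPoly.coeff (K.dimSucc - i) * K.hPoly.coeff j

theorem hRatio_le_iff {i j : ℕ} (hi : i ≤ K.dimSucc) (hj : j ≤ K.dimSucc)
    (hci : 0 < K.hPoly.coeff i) (hcj : 0 < K.hPoly.coeff j) :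
    K.hRatio i ≤ K.hRatio j ↔ K.hPoly.coeff (K.dimSucc - i) * K.hPoly.coeff j ≤
      K.hPoly.coeff (K.dimSucc - j) * K.hPoly.coeff i := by
  rw [hRatio_eq hi, hRatio_eq hj, div_le_div_iff₀ (by exact_mod_cast hci) (by exact_mod_cast hcj)]
  exact_mod_cast Iff.rfl

theorem IncreasingMinors.barycentricSubdivision (hK : K.faces.Finite) (h : K.IncreasingMinors) :
    K.barycentricSubdivision.IncreasingMinors := by
  intro i j hij hj
  rw [dimSucc_barycentricSubdivision hK] at hj ⊢
  rw [coeff_hPoly_barycentricSubdivision_rev hK (hij.trans hj),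
    coeff_hPoly_barycentricSubdivision_rev hK hj, coeff_hPoly_barycentricSubdivision hK,
    coeff_hPoly_barycentricSubdivision hK]
  have key := sum_mul_sum_le_of_minors (Finset.range (K.dimSucc + 1)) (fun r => K.hPoly.coeff r)
    (fun r => K.hPoly.coeff (K.dimSucc - r)) (fun r => (descentPoly K.dimSucc r).coeff i)
    (fun r => (descentPoly K.dimSucc r).coeff j)
    (fun r _ s hs hrs => by linarith [h r s hrs (Finset.mem_range_succ_iff.1 hs)])
    fun r _ s _ hrs => by linarith [descentPoly.coeff_mul_coeff_le K.dimSucc hrs hij]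
  linarith

theorem DecreasingMinors.barycentricSubdivision (hK : K.faces.Finite) (h : K.DecreasingMinors) :
    K.barycentricSubdivision.DecreasingMinors := by
  intro i j hij hj
  rw [dimSucc_barycentricSubdivision hK] at hj ⊢
  rw [coeff_hPoly_barycentricSubdivision_rev hK (hij.trans hj),
    coeff_hPoly_barycentricSubdivision_rev hK hj, coeff_hPoly_barycentricSubdivision hK,
    coeff_hPoly_barycentricSubdivision hK]
  exact sum_mul_sum_le_of_minors _ _ _ _ _
    (fun r _ s hs hrs => h r s hrs (Finset.mem_range_succ_iff.1 hs))
    fun r _ s _ hrs => by linarith [descentPoly.coeff_mul_coeff_le K.dimSucc hrs hij]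

theorem coeff_hPoly_eq_hVec {m : ℕ} (hm : m ≤ K.dimSucc) :
    K.hPoly.coeff m = K.hVec (K.dimSucc - m) := by
  rw [hVec, Nat.sub_sub_self hm]

theorem IncreasingRatios.increasingMinors (h : K.IncreasingRatios) : K.IncreasingMinors := by
  have hpos : ∀ m ≤ K.dimSucc, 0 < K.hPoly.coeff m := fun m hm => by
    rw [coeff_hPoly_eq_hVec hm]
    exact h.1 _ (Nat.sub_le _ _)
  intro i j hij hj
  rw [← hRatio_le_iff (hij.trans hj) hj (hpos _ (hij.trans hj)) (hpos _ hj)]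
  induction j, hij using Nat.le_induction with
  | base => exact le_rfl
  | succ j _ ih => exact (ih (by omega)).trans (h.2 j hj)

theorem IncreasingRatios.barycentricSubdivision (hK : K.faces.Finite) (h : K.IncreasingRatios) :
    K.barycentricSubdivision.IncreasingRatios := by
  have hpos : ∀ m ≤ K.dimSucc, 0 < K.barycentricSubdivision.hPoly.coeff m := by
    intro m hm
    rw [coeff_hPoly_barycentricSubdivision hK]
    have hc : ∀ r ≤ K.dimSucc, 0 < K.hPoly.coeff r := fun r hr => by
      rw [coeff_hPoly_eq_hVec hr]
      exact h.1 _ (Nat.sub_le _ _)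
    obtain ⟨r, hr, hr'⟩ := descentPoly.exists_coeff_pos hm
    exact Finset.sum_pos' (fun s hs => mul_nonneg (hc s (Finset.mem_range_succ_iff.1 hs)).le
      (descentPoly.coeff_nonneg _ _ _)) ⟨r, Finset.mem_range_succ_iff.2 hr, mul_pos (hc r hr) hr'⟩
  have hd := dimSucc_barycentricSubdivision hK
  refine ⟨fun i hi => ?_, fun i hi => ?_⟩
  · rw [hVec, hd]
    exact hpos _ (Nat.sub_le _ _)
  · rw [hRatio_le_iff (by omega) hi (hpos _ (by omega)) (hpos _ (by omega))]
    exact h.increasingMinors.barycentricSubdivision hK _ _ i.le_succ hi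

theorem DecreasingRatios.coeff_pos (h : K.DecreasingRatios) {m : ℕ} (hm : 1 ≤ m)
    (hm' : m + 1 ≤ K.dimSucc) : 0 < K.hPoly.coeff m := by
  rw [coeff_hPoly_eq_hVec (by omega)]
  exact h.1 _ (by omega) (by omega)

theorem DecreasingRatios.coeff_zero (h : K.DecreasingRatios) : K.hPoly.coeff 0 = 0 := by
  rw [coeff_hPoly_eq_hVec (Nat.zero_le _)]
  exact h.2.1

theorem coeff_dimSucc (K : PreAbstractSimplicialComplex ι) : K.hPoly.coeff K.dimSucc = 1 := by
  rw [coeff_hPoly_eq_hVec le_rfl, Nat.sub_self, hVec_zero]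

theorem DecreasingRatios.coeff_nonneg (h : K.DecreasingRatios) {m : ℕ} (hm : m ≤ K.dimSucc) :
    0 ≤ K.hPoly.coeff m := by
  rcases Nat.eq_zero_or_pos m with rfl | h0
  · exact h.coeff_zero.ge
  · rcases hm.lt_or_eq with h1 | rfl
    · exact (h.coeff_pos h0 h1).le
    · rw [coeff_dimSucc]
      exact zero_le_one

/-- The ratios are compared only for 0 < i ≤ j < d. At the ends h_d = 0 kills one product, and the
other is nonnegative. -/
theorem DecreasingRatios.decreasingMinors (h : K.DecreasingRatios) : K.DecreasingMinors := by
  intro i j hij hj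
  rcases Nat.eq_zero_or_pos i with rfl | hi
  · rw [h.coeff_zero, mul_zero]
    exact mul_nonneg (h.coeff_nonneg (Nat.sub_le _ _)) (h.coeff_nonneg hj)
  rcases hj.eq_or_lt with rfl | hj
  · rw [Nat.sub_self, h.coeff_zero, zero_mul]
    exact mul_nonneg (h.coeff_nonneg (Nat.sub_le _ _)) (h.coeff_nonneg le_rfl)
  rw [← hRatio_le_iff hj.le (by omega) (h.coeff_pos (by omega) hj) (h.coeff_pos hi (by omega))]
  induction j, hij using Nat.le_induction with
  | base => exact le_rfl
  | succ j _ ih => exact (h.2.2 j (by omega) hj).trans (ih (by omega) (by omega))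

theorem DecreasingRatios.barycentricSubdivision (hK : K.faces.Finite) (h : K.DecreasingRatios) :
    K.barycentricSubdivision.DecreasingRatios := by
  have hpos : ∀ m, 1 ≤ m → m + 1 ≤ K.dimSucc → 0 < K.barycentricSubdivision.hPoly.coeff m := by
    intro m hm hm'
    rw [coeff_hPoly_barycentricSubdivision hK]
    -- The term `r = 0` vanishes because h_d = 0, so positivity is taken from `r = 1`, where h_{d-1}
    -- > 0.
    refine Finset.sum_pos' (fun s hs => mul_nonneg
      (h.coeff_nonneg (Finset.mem_range_succ_iff.1 hs)) (descentPoly.coeff_nonneg _ _ _))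
      ⟨1, Finset.mem_range_succ_iff.2 (by omega), mul_pos (h.coeff_pos le_rfl (by omega)) ?_⟩
    obtain ⟨d, hd⟩ := Nat.exists_eq_add_of_le' (show 2 ≤ K.dimSucc by omega)
    obtain ⟨n, rfl⟩ := Nat.exists_eq_add_of_le' hm
    rw [hd]
    exact descentPoly.coeff_one_pos (by omega)
  have hd := dimSucc_barycentricSubdivision hK
  refine ⟨fun i hi hi' => ?_, ?_, fun i hi hi' => ?_⟩
  · rw [hd] at hi'
    rw [hVec, hd]
    exact hpos _ (by omega) (by omega)
  · rw [hVec, Nat.sub_self, coeff_hPoly_barycentricSubdivision hK]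
    refine Finset.sum_eq_zero fun r _ => ?_
    -- The constant term of F_r is zero for `r > 0`, since a permutation not starting with its
    -- smallest letter has a descent; the weight at `r = 0` is h_d = 0.
    rcases Nat.eq_zero_or_pos r with rfl | hr
    · rw [h.coeff_zero, zero_mul]
    · rw [descentPoly.coeff_zero_of_pos _ hr, mul_zero]
  · rw [hRatio_le_iff (by omega) (by omega) (hpos _ (by omega) (by omega))
      (hpos _ hi (by omega))]
    exact h.decreasingMinors.barycentricSubdivision hK _ _ i.le_succ (by omega)

end PreAbstractSimplicialComplex

theorem mainTheorem3 {ι : Type*} (K : PreAbstractSimplicialComplex ι) (hK : K.faces.Finite) :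
    (K.IncreasingRatios → K.barycentricSubdivision.IncreasingRatios) ∧
      (K.DecreasingRatios → K.barycentricSubdivision.DecreasingRatios) :=
  ⟨fun h => h.barycentricSubdivision hK, fun h => h.barycentricSubdivision hK⟩
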